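/- **Setting.** Let $d_1,d_2\ge 0$ be integers, $d=d_1+d_2$, and write points of $\mathbb R^d$ as $(x,y)\in\mathbb R^{d_1}\times\mathbb R^{d_2}$. Let $E(n)$ be the group of all isometries $x\mapsto Ax+b$ of $\mathbb R^n$, and $\mathrm{rot}(g)=A\in O(n)$ for $g:x\mapsto Ax+b$. A subgroup of $E(n)$ is *discrete* if all its orbits in $\mathbb R^n$ are discrete sets; a *space group* in dimension $n$ is a discrete subgroup of $E(n)$ that contains $n$ translations with linearly independent translation vectors. For $A\in O(d_1)$, $s\in E(d_2)$ let $A\oplus s\in E(d)$ be the map $(x,y)\mapsto (Ax,s(y))$, and let $\pi(A\oplus s)=s$. Let $\mathcal S<E(d_2)$ be a space group, let $\mathcal G<O(d_1)\oplus\mathcal S$ be a discrete subgroup of $E(d)$ with $\pi(\mathcal G)=\mathcal S$, and let $x_0\in\mathbb R^d$ be such that $g\mapsto g\cdot x_0$ is injective on $\mathcal G$. Fix a set $\mathcal T\subset\mathcal G$ that $\pi$ maps bijectively onto the set of translations in $\mathcal S$. For $N\in\mathbb N$ put $\mathcal T^N=\{t^N: t\in\mathcal T\}$, and let $M_0$ be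 the set of all integers $N\ge 1$ for which $\mathcal T^N$ is a normal subgroup of $\mathcal G$ (it then has finite index). A map $u:\mathcal G\to\mathbb R^d$ is *$\mathcal T^N$-periodic* if $u(gt)=u(g)$ for all $g\in\mathcal G$, $t\in\mathcal T^N$. It is *periodic* if it is $\mathcal T^N$-periodic for some $N\in M_0$, and $U_{\rm per}$ denotes the set of all periodic $u:\mathcal G\to\mathbb R^d$. For $N\in M_0$ let $\mathcal C_N$ be a set of representatives of $\mathcal G/\mathcal T^N$. For a finite set $\mathcal R\subset\mathcal G$, equip $\{w:\mathcal R\to\mathbb R^d\}$ with the norm $\|w\|=(\sum_{h\in\mathcal R}|w(h)|^2)^{1/2}$. Let $U_{\rm iso}(\mathcal R)$ be the space of all $w:\mathcal R\to\mathbb R^d$ of the form $$w(h)=\mathrm{rot}(h)^T\bigl(a+S(h\cdot x_0-x_0)\bigr)\quad(h\in\mathcal R),\qquad a\in\mathbb R^d,\quad S=\begin{pmatrix}S_1&S_2\\-S_2^T&S_3\end{pmatrix},$$ with $S_1\in\mathbb R^{d_1\times d_1}$ and $S_3\in\mathbb R^{d_2\times d_2}$ skew symmetric and $S_2\in\mathbb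 R^{d_1\times d_2}$ arbitrary, and let $U_{{\rm iso},0}(\mathcal R)$ be the subspace of those $w$ that admit such a representation with $S_3=0$. For a subspace $U$ let $\pi_U$ be the orthogonal projection with kernel $U$. For $\mathcal T^N$-periodic $u$, $N\in M_0$, set $$\|u\|_{\mathcal R}=\Bigl(\frac1{|\mathcal C_N|}\sum_{g\in\mathcal C_N}\bigl\|\pi_{U_{\rm iso}(\mathcal R)}\bigl(u(g\,\cdot)|_{\mathcal R}\bigr)\bigr\|^2\Bigr)^{1/2},\qquad \|u\|_{\mathcal R,0}=\Bigl(\frac1{|\mathcal C_N|}\sum_{g\in\mathcal C_N}\bigl\|\pi_{U_{{\rm iso},0}(\mathcal R)}\bigl(u(g\,\cdot)|_{\mathcal R}\bigr)\bigr\|^2\Bigr)^{1/2}.$$ (These values do not depend on the choice of $N$ and $\mathcal C_N$.) A set $\mathcal R\subset\mathcal G$ has *Property 1* if it is finite, contains the identity, and $\mathcal R\cdot x_0$ and $\mathcal G\cdot x_0$ have the same affine hull. It has *Property 2* if it is finite and there are $\mathcal R',\mathcal R''\subset\mathcal G$ such that $\mathcal R'$ contains the identity and generates $\mathcal G$, $\mathcal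 R''$ has Property 1, and $\mathcal R'\mathcal R''\subset\mathcal R$. **Theorem (a discrete Korn inequality).** Suppose that $\mathcal R\subset\mathcal G$ has Property 2. Then the seminorms $\|\cdot\|_{\mathcal R}$ and $\|\cdot\|_{\mathcal R,0}$ on $U_{\rm per}$ are equivalent: there are constants $c,C>0$ such that for all $u\in U_{\rm per}$ $$c\,\|u\|_{\mathcal R,0}\le\|u\|_{\mathcal R}\le C\,\|u\|_{\mathcal R,0}.$$ The constants do not depend on the period $N\in M_0$ of $u$ or on the choice of $\mathcal C_N$. -/

import Mathlib

namespace ObjectiveStructure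

noncomputable section

/-- The Euclidean group of the Euclidean space `ℝ^ι`: all isometries of the space onto itself, with
composition as multiplication. -/
abbrev EuclideanGroup (ι : Type) [Fintype ι] : Type :=
  EuclideanSpace ℝ ι ≃ᵃⁱ[ℝ] EuclideanSpace ℝ ι

/-- The orthogonal group of `ℝ^ι`: all linear isometries of the space onto itself. -/
abbrev OrthogonalGroup (ι : Type) [Fintype ι] : Type :=
  EuclideanSpace ℝ ι ≃ₗᵢ[ℝ] EuclideanSpace ℝ ι

/-- The linear component `A` of the isometry `x ↦ A x + b`. -/
def rot {ι : Type} [Fintype ι] (g : EuclideanGroup ι) : OrthogonalGroup ι :=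
  g.linearIsometryEquiv

/-- The translation `x ↦ v + x`. -/
def translation {ι : Type} [Fintype ι] (v : EuclideanSpace ℝ ι) : EuclideanGroup ι :=
  AffineIsometryEquiv.constVAdd ℝ (EuclideanSpace ℝ ι) v

/-- A group of isometries is discrete if each of its orbits is a discrete set. -/
def IsDiscreteGroup {ι : Type} [Fintype ι] (G : Subgroup (EuclideanGroup ι)) : Prop :=
  ∀ x : EuclideanSpace ℝ ι, IsDiscrete (Set.range fun g : G => (g : EuclideanGroup ι) x)

/-- A space group in dimension `n`: a discrete group of isometries of `ℝ^n` that contains `n`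
translations with linearly independent translation vectors. -/
def IsSpaceGroup {n : ℕ} (S : Subgroup (EuclideanGroup (Fin n))) : Prop :=
  IsDiscreteGroup S ∧
    ∃ b : Fin n → EuclideanSpace ℝ (Fin n),
      LinearIndependent ℝ b ∧ ∀ i, translation (b i) ∈ S

/-- The space `ℝ^(d₁ + d₂) = ℝ^d₁ × ℝ^d₂` with the Euclidean norm. -/
abbrev Space (d₁ d₂ : ℕ) : Type := EuclideanSpace ℝ (Fin d₁ ⊕ Fin d₂)

/-- The point `(x, y)` of `ℝ^d₁ × ℝ^d₂`. -/
def join {d₁ d₂ : ℕ} (x : EuclideanSpace ℝ (Fin d₁)) (y : EuclideanSpace ℝ (Fin d₂)) :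
    Space d₁ d₂ :=
  WithLp.toLp 2 (Sum.elim (fun i => x i) (fun j => y j))

/-- `g = A ⊕ s`, that is, `g (x, y) = (A x, s y)` for all `x ∈ ℝ^d₁` and `y ∈ ℝ^d₂`. -/
def IsDirectSum {d₁ d₂ : ℕ} (A : OrthogonalGroup (Fin d₁)) (s : EuclideanGroup (Fin d₂))
    (g : EuclideanGroup (Fin d₁ ⊕ Fin d₂)) : Prop :=
  ∀ x y, g (join x y) = join (A x) (s y)

/-- `π(g) = s`, where `π` is the natural projection `O(d₁) ⊕ E(d₂) → E(d₂)`, `A ⊕ s ↦ s`. -/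
def ProjectsTo {d₁ d₂ : ℕ} (g : EuclideanGroup (Fin d₁ ⊕ Fin d₂))
    (s : EuclideanGroup (Fin d₂)) : Prop :=
  ∃ A : OrthogonalGroup (Fin d₁), IsDirectSum A s g

/-- `G` is a subgroup of `O(d₁) ⊕ S` and `π(G) = S`. -/
def ProjectsOnto {d₁ d₂ : ℕ} (G : Subgroup (EuclideanGroup (Fin d₁ ⊕ Fin d₂)))
    (S : Subgroup (EuclideanGroup (Fin d₂))) : Prop :=
  (∀ g ∈ G, ∃ s ∈ S, ProjectsTo g s) ∧ (∀ s ∈ S, ∃ g ∈ G, ProjectsTo g s)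

/-- `T ⊆ G` is a section of the translation group of `S`: the projection `π` maps `T` bijectively
onto the set of all translations that belong to `S`. -/
def IsTranslationSection {d₁ d₂ : ℕ} {G : Subgroup (EuclideanGroup (Fin d₁ ⊕ Fin d₂))}
    (S : Subgroup (EuclideanGroup (Fin d₂))) (T : Set G) : Prop :=
  (∀ t ∈ T, ∃ v, translation v ∈ S ∧
      ProjectsTo (t : EuclideanGroup (Fin d₁ ⊕ Fin d₂)) (translation v)) ∧
  ∀ v, translation v ∈ S →
    ∃! t : G, t ∈ T ∧ ProjectsTo (t : EuclideanGroup (Fin d₁ ⊕ Fin d₂)) (translation v)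

section Group

variable {Γ : Type} [Group Γ]

/-- `T^N = {t^N : t ∈ T}`. -/
def powerSet (T : Set Γ) (N : ℕ) : Set Γ := {g | ∃ t ∈ T, t ^ N = g}

/-- The admissible periods: the positive integers `N` for which `T^N` is a normal subgroup. -/
def admissiblePeriods (T : Set Γ) : Set ℕ :=
  {N | 0 < N ∧ ∃ H : Subgroup Γ, H.Normal ∧ (H : Set Γ) = powerSet T N}

/-- `u` is `T^N`-periodic. -/
def IsPeriodic {X : Type} (T : Set Γ) (N : ℕ) (u : Γ → X) : Prop :=
  ∀ g : Γ, ∀ t ∈ powerSet T N, u g = u (g * t)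

/-- The finite set `C` contains exactly one element of each coset `g T^N`. -/
def IsRepresentationSet (T : Set Γ) (N : ℕ) (C : Finset Γ) : Prop :=
  ∀ g : Γ, ∃! c : Γ, c ∈ C ∧ ∃ t ∈ powerSet T N, g = c * t

end Group

/-- The space `Skew(d)` of all real skew symmetric matrices. -/
def skew (ι : Type) : Submodule ℝ (Matrix ι ι ℝ) where
  carrier := {A | A.transpose = -A}
  zero_mem' := by simp
  add_mem' := by
    intro A B hA hB
    simp only [Set.mem_ofPred_eq] at hA hB ⊢
    rw [Matrix.transpose_add, hA, hB, neg_add]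
  smul_mem' := by
    intro r A hA
    simp only [Set.mem_ofPred_eq] at hA ⊢
    rw [Matrix.transpose_smul, hA, smul_neg]

/-- The space of all block matrices `(S₁, S₂; -S₂ᵀ, 0)` with `S₁ ∈ Skew(d₁)` and
`S₂ ∈ ℝ^(d₁ × d₂)`. -/
def skewZero (d₁ d₂ : ℕ) : Submodule ℝ (Matrix (Fin d₁ ⊕ Fin d₂) (Fin d₁ ⊕ Fin d₂) ℝ) where
  carrier := {A | ∃ S₁ ∈ skew (Fin d₁), ∃ S₂ : Matrix (Fin d₁) (Fin d₂) ℝ,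
    A = Matrix.fromBlocks S₁ S₂ (-S₂.transpose) 0}
  zero_mem' := ⟨0, Submodule.zero_mem _, 0, by simp⟩
  add_mem' := by
    rintro _ _ ⟨S₁, h₁, S₂, rfl⟩ ⟨S₁', h₁', S₂', rfl⟩
    refine ⟨S₁ + S₁', Submodule.add_mem _ h₁ h₁', S₂ + S₂', ?_⟩
    rw [Matrix.fromBlocks_add, Matrix.transpose_add, neg_add, add_zero]
  smul_mem' := by
    rintro r _ ⟨S₁, h₁, S₂, rfl⟩
    refine ⟨r • S₁, Submodule.smul_mem _ r h₁, r • S₂, ?_⟩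
    rw [Matrix.fromBlocks_smul, Matrix.transpose_smul, smul_neg, smul_zero]

section Seminorms

variable {d₁ d₂ : ℕ} {G : Subgroup (EuclideanGroup (Fin d₁ ⊕ Fin d₂))}

/-- The point `g · x₀`. -/
def act (g : G) (x₀ : Space d₁ d₂) : Space d₁ d₂ := (g : EuclideanGroup (Fin d₁ ⊕ Fin d₂)) x₀

/-- The space of all maps `R → ℝ^d`, with the norm `(∑_{h ∈ R} ‖u(h)‖²)^(1/2)`. -/
abbrev PatchMap (R : Finset G) : Type := PiLp 2 fun _ : R => Space d₁ d₂

/-- The infinitesimal translations on the patch `R`: the maps `u` such that `rot(h) u(h)` is the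
same vector for all `h ∈ R`. -/
def transSpace (R : Finset G) : Submodule ℝ (PatchMap R) where
  carrier := {u | ∃ a : Space d₁ d₂, ∀ h : R, rot (h : G).1 (u h) = a}
  zero_mem' := ⟨0, fun h => by simp⟩
  add_mem' := by
    rintro u v ⟨a, ha⟩ ⟨b, hb⟩
    exact ⟨a + b, fun h => by rw [PiLp.add_apply, map_add, ha, hb]⟩
  smul_mem' := by
    rintro r u ⟨a, ha⟩
    exact ⟨r • a, fun h => by rw [PiLp.smul_apply, map_smul, ha]⟩

/-- The infinitesimal rotations on the patch `R` with skew part in the space `K` of matrices: the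
maps `u` such that, for some `S ∈ K`, `rot(h) u(h) = S (h · x₀ - x₀)` for all `h ∈ R`. -/
def rotSpace (K : Submodule ℝ (Matrix (Fin d₁ ⊕ Fin d₂) (Fin d₁ ⊕ Fin d₂) ℝ))
    (x₀ : Space d₁ d₂) (R : Finset G) : Submodule ℝ (PatchMap R) where
  carrier := {u | ∃ S ∈ K, ∀ h : R,
    rot (h : G).1 (u h) = Matrix.toEuclideanLin S (act (h : G) x₀ - x₀)}
  zero_mem' := ⟨0, Submodule.zero_mem _, fun h => by simp⟩
  add_mem' := by
    rintro u v ⟨A, hA, ha⟩ ⟨B, hB, hb⟩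
    exact ⟨A + B, Submodule.add_mem _ hA hB, fun h => by
      rw [PiLp.add_apply, map_add, ha, hb, map_add, LinearMap.add_apply]⟩
  smul_mem' := by
    rintro r u ⟨A, hA, ha⟩
    exact ⟨r • A, Submodule.smul_mem _ r hA, fun h => by
      rw [PiLp.smul_apply, map_smul, ha, map_smul, LinearMap.smul_apply]⟩

/-- `U_iso(R)`: all infinitesimal isometries on the patch `R`. -/
def isoSpace (x₀ : Space d₁ d₂) (R : Finset G) : Submodule ℝ (PatchMap R) :=
  transSpace R ⊔ rotSpace (skew (Fin d₁ ⊕ Fin d₂)) x₀ R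

/-- `U_{iso,0}(R)`: the infinitesimal isometries on the patch `R` whose skew part has vanishing
lower right `d₂ × d₂` block. -/
def isoSpaceZero (x₀ : Space d₁ d₂) (R : Finset G) : Submodule ℝ (PatchMap R) :=
  transSpace R ⊔ rotSpace (skewZero d₁ d₂) x₀ R

/-- The restriction `u(g ·)|_R`. -/
def patch (R : Finset G) (u : G → Space d₁ d₂) (g : G) : PatchMap R :=
  WithLp.toLp 2 fun h => u (g * h)

/-- The root mean square over `g ∈ C` of `‖π_U (u(g ·)|_R)‖`, where `π_U` is the orthogonal
projection with kernel `U`. -/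
def patchSeminorm (R : Finset G) (U : Submodule ℝ (PatchMap R)) (C : Finset G)
    (u : G → Space d₁ d₂) : ℝ :=
  Real.sqrt ((1 / (C.card : ℝ)) * ∑ g ∈ C, ‖Uᗮ.starProjection (patch R u g)‖ ^ 2)

/-- The value `‖u‖_R` of the local rigidity seminorm at a `T^N`-periodic `u`, computed with a
representation set `C` of `G / T^N`. -/
def rigiditySeminorm (x₀ : Space d₁ d₂) (R : Finset G) (C : Finset G)
    (u : G → Space d₁ d₂) : ℝ :=
  patchSeminorm R (isoSpace x₀ R) C u

/-- The value `‖u‖_{R,0}` of the intrinsic seminorm at a `T^N`-periodic `u`, computed with a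
representation set `C` of `G / T^N`. -/
def intrinsicSeminorm (x₀ : Space d₁ d₂) (R : Finset G) (C : Finset G)
    (u : G → Space d₁ d₂) : ℝ :=
  patchSeminorm R (isoSpaceZero x₀ R) C u

/-- Property 1: `R` is finite, contains the identity, and `R · x₀` has the same affine hull as
`G · x₀`. -/
def HasProperty1 (x₀ : Space d₁ d₂) (R : Set G) : Prop :=
  R.Finite ∧ 1 ∈ R ∧
    affineSpan ℝ ((fun g : G => act g x₀) '' R) = affineSpan ℝ (Set.range fun g : G => act g x₀)

/-- Property 2: the finite set `R` contains a product `R' R''`, where `R'` contains the identity and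
generates `G`, and `R''` has Property 1. -/
def HasProperty2 (x₀ : Space d₁ d₂) (R : Finset G) : Prop :=
  ∃ R' R'' : Set G, 1 ∈ R' ∧ Subgroup.closure R' = ⊤ ∧ HasProperty1 x₀ R'' ∧
    ∀ a ∈ R', ∀ b ∈ R'', a * b ∈ R

end Seminorms

end

end ObjectiveStructure

namespace ObjectiveStructure

/-! ### Transversals and controlled quantities -/

section Controlled

variable {Γ X : Type} [Group Γ]

/-! The bound `‖u‖_R ≤ ‖u‖_{R,0}` only says that distance decreases when the subspace grows. For the
converse, choose at every `g` the skew matrix `A(g)` of the best infinitesimal isometry on the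
patch. The task is to bound its lower right block in mean square by the local defect, with a
constant independent of the period; `IsControlled` expresses such bounds, which are stable under
linear operations and right shifts.

Since the patch contains `R' R''`, the affine fields at `g` and `g r`, `r ∈ R'`, nearly agree on
`R'' x₀`, hence on its affine hull, which contains `G x₀`. As `R'` generates `G`, the field at `g`
approximates `rot(w) u(g w)` for every fixed `w` (`isControlled_sub_affineField`).

Next take commuting `s, t ∈ T^N`, with translation vectors `c, c'` fixed by both linear parts.
Polynomial weights (`exists_polynomial_of_isometry`) average out the rotation of `x₀`, so
differences of the filtered components of `u` along `c'` and `c` read off entries of `A(g)`: along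
`s` they give `⟨c', A c⟩` and `⟨c, A c⟩ = 0`, along `t` they give `⟨c', A c'⟩ = 0` and `⟨c, A c'⟩ =
-⟨c', A c⟩`. Thus the symmetrized differences are controlled, and summation by parts, as in Korn's
inequality for periodic fields, controls the mixed difference itself (`IsControlled.korn`). The
vectors `c` span `ℝ^d₂`, so the whole block is controlled. -/

/-- The finite set `C` contains exactly one element of each left coset of `H`. -/
def IsTransversal (H : Subgroup Γ) (C : Finset Γ) : Prop :=
  ∀ g : Γ, ∃! c : Γ, c ∈ C ∧ ∃ t ∈ H, g = c * t

/-- `u` is invariant under right multiplication by elements of `H`. -/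
def IsInvariant {Y : Type*} (H : Subgroup Γ) (u : Γ → Y) : Prop :=
  ∀ g, ∀ t ∈ H, u (g * t) = u g

theorem IsInvariant.comp_mul_right {Y : Type*} {H : Subgroup Γ} (hH : H.Normal) {u : Γ → Y}
    (hu : IsInvariant H u) (w : Γ) : IsInvariant H fun g => u (g * w) := by
  intro g t ht
  have h : g * t * w = g * w * (w⁻¹ * t * w⁻¹⁻¹) := by group
  simp only [h]
  exact hu _ _ (hH.conj_mem t ht w⁻¹)

theorem IsTransversal.sum_eq {H : Subgroup Γ} {C C' : Finset Γ} (hC : IsTransversal H C)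
    (hC' : IsTransversal H C') {φ : Γ → ℝ} (hφ : IsInvariant H φ) :
    ∑ g ∈ C, φ g = ∑ g ∈ C', φ g := by
  choose i hi hi' using hC'
  refine Finset.sum_bij (fun g _ => i g) (fun g _ => (hi g).1) ?_ ?_ ?_
  · intro a ha b hb hab
    obtain ⟨-, t, ht, hat⟩ := hi a
    obtain ⟨-, t', ht', hbt⟩ := hi b
    refine (hC a).unique ⟨ha, 1, H.one_mem, by simp⟩ ⟨hb, t'⁻¹ * t, H.mul_mem (H.inv_mem ht') ht, ?_⟩
    rw [hbt, ← hab]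
    nth_rewrite 1 [hat]
    group
  · intro b hb
    obtain ⟨c, ⟨hc, t, ht, hbt⟩, -⟩ := hC b
    refine ⟨c, hc, ?_⟩
    exact ((hi' c) b ⟨hb, t⁻¹, H.inv_mem ht, by rw [hbt]; group⟩).symm
  · intro a _
    obtain ⟨-, t, ht, hat⟩ := hi a
    nth_rewrite 1 [hat]
    exact hφ _ _ ht

theorem IsTransversal.image_mul_right [DecidableEq Γ] {H : Subgroup Γ} (hH : H.Normal)
    {C : Finset Γ} (hC : IsTransversal H C) (w : Γ) : IsTransversal H (C.image (· * w)) := by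
  intro g
  obtain ⟨c, ⟨hc, t, ht, hct⟩, huniq⟩ := hC (g * w⁻¹)
  refine ⟨c * w, ⟨Finset.mem_image_of_mem _ hc, w⁻¹ * t * w⁻¹⁻¹, hH.conj_mem t ht w⁻¹, ?_⟩, ?_⟩
  · rw [mul_inv_eq_iff_eq_mul.mp hct]
    group
  · rintro _ ⟨hcw, t', ht', hg⟩
    obtain ⟨c', hc', rfl⟩ := Finset.mem_image.mp hcw
    have : c' = c := huniq c' ⟨hc', w * t' * w⁻¹, hH.conj_mem t' ht' w, by rw [hg]; group⟩
    rw [this]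

theorem IsTransversal.sum_mul_right {H : Subgroup Γ} (hH : H.Normal) {C : Finset Γ}
    (hC : IsTransversal H C) {φ : Γ → ℝ} (hφ : IsInvariant H φ) (w : Γ) :
    ∑ g ∈ C, φ (g * w) = ∑ g ∈ C, φ g := by
  classical
  rw [← Finset.sum_image (g := (· * w)) (fun a _ b _ h => mul_right_cancel h)]
  exact (hC.image_mul_right hH w).sum_eq hC hφ

/-- The quantity `e u g` is controlled by `δ u g` in mean square, uniformly over all normal
subgroups `H` of finite index and all `H`-periodic `u`. -/
def IsControlled {E : Type*} [NormedAddCommGroup E] (δ : (Γ → X) → Γ → ℝ)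
    (e : (Γ → X) → Γ → E) : Prop :=
  ∃ K : ℝ, 0 ≤ K ∧ ∀ H : Subgroup Γ, H.Normal → ∀ C : Finset Γ, IsTransversal H C →
    ∀ u : Γ → X, IsInvariant H u → ∑ g ∈ C, ‖e u g‖ ^ 2 ≤ K * ∑ g ∈ C, δ u g ^ 2

namespace IsControlled

variable {E E' : Type*} [NormedAddCommGroup E] [NormedAddCommGroup E'] {δ : (Γ → X) → Γ → ℝ}

theorem mono {e : (Γ → X) → Γ → E} {e' : (Γ → X) → Γ → E'} (he : IsControlled δ e) (M : ℝ)
    (h : ∀ u g, ‖e' u g‖ ≤ M * ‖e u g‖) : IsControlled δ e' := by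
  obtain ⟨K, hK, he⟩ := he
  refine ⟨M ^ 2 * K, by positivity, fun H hH C hC u hu => ?_⟩
  calc ∑ g ∈ C, ‖e' u g‖ ^ 2 ≤ ∑ g ∈ C, M ^ 2 * ‖e u g‖ ^ 2 := by
        refine Finset.sum_le_sum fun g _ => ?_
        rw [← mul_pow]
        exact pow_le_pow_left₀ (norm_nonneg _) (h u g) 2
    _ = M ^ 2 * ∑ g ∈ C, ‖e u g‖ ^ 2 := by rw [Finset.mul_sum]
    _ ≤ M ^ 2 * (K * ∑ g ∈ C, δ u g ^ 2) := by gcongr; exact he H hH C hC u hu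
    _ = _ := by ring

theorem of_norm_le {e : (Γ → X) → Γ → E} (h : ∀ u g, ‖e u g‖ ≤ δ u g) : IsControlled δ e :=
  ⟨1, zero_le_one, fun _ _ C _ u _ => by
    rw [one_mul]
    exact Finset.sum_le_sum fun g _ => pow_le_pow_left₀ (norm_nonneg _) (h u g) 2⟩

theorem zero : IsControlled δ fun _ _ => (0 : E) :=
  ⟨0, le_rfl, fun _ _ C _ u _ => by simp⟩

theorem add {e e' : (Γ → X) → Γ → E} (he : IsControlled δ e) (he' : IsControlled δ e') :
    IsControlled δ fun u g => e u g + e' u g := by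
  obtain ⟨K, hK, he⟩ := he
  obtain ⟨K', hK', he'⟩ := he'
  refine ⟨2 * K + 2 * K', by positivity, fun H hH C hC u hu => ?_⟩
  calc ∑ g ∈ C, ‖e u g + e' u g‖ ^ 2
      ≤ ∑ g ∈ C, (2 * ‖e u g‖ ^ 2 + 2 * ‖e' u g‖ ^ 2) := by
        refine Finset.sum_le_sum fun g _ => ?_
        have := pow_le_pow_left₀ (norm_nonneg _) (norm_add_le (e u g) (e' u g)) 2
        nlinarith [sq_nonneg (‖e u g‖ - ‖e' u g‖)]
    _ = 2 * ∑ g ∈ C, ‖e u g‖ ^ 2 + 2 * ∑ g ∈ C, ‖e' u g‖ ^ 2 := by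
        rw [Finset.sum_add_distrib, Finset.mul_sum, Finset.mul_sum]
    _ ≤ _ := by linarith [he H hH C hC u hu, he' H hH C hC u hu]

theorem neg {e : (Γ → X) → Γ → E} (he : IsControlled δ e) : IsControlled δ fun u g => -e u g :=
  he.mono 1 fun u g => by simp

theorem sub {e e' : (Γ → X) → Γ → E} (he : IsControlled δ e) (he' : IsControlled δ e') :
    IsControlled δ fun u g => e u g - e' u g := by
  simpa only [sub_eq_add_neg] using he.add he'.neg

theorem sum {ι : Type*} (A : Finset ι) {e : ι → (Γ → X) → Γ → E}
    (he : ∀ i ∈ A, IsControlled δ (e i)) : IsControlled δ fun u g => ∑ i ∈ A, e i u g := by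
  classical
  induction A using Finset.induction_on with
  | empty => simpa using zero
  | insert i A hi ih =>
    simp only [Finset.sum_insert hi]
    exact (he i (Finset.mem_insert_self _ _)).add
      (ih fun j hj => he j (Finset.mem_insert_of_mem hj))

theorem map [NormedSpace ℝ E] [NormedSpace ℝ E'] {e : (Γ → X) → Γ → E} (he : IsControlled δ e)
    (L : E →L[ℝ] E') : IsControlled δ fun u g => L (e u g) :=
  he.mono ‖L‖ fun _ _ => L.le_opNorm _

theorem const_smul [NormedSpace ℝ E] {e : (Γ → X) → Γ → E} (he : IsControlled δ e) (r : ℝ) :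
    IsControlled δ fun u g => r • e u g :=
  he.mono ‖r‖ fun _ _ => by rw [norm_smul]

/-- Normality makes `C w` a transversal whenever `C` is one, and the sum of `δ²` is the same over
both. Only `δ` has to be invariant: the bound for `e` is assumed over every transversal, so `e` may
depend on non-periodic choices. -/
theorem shift {e : (Γ → X) → Γ → E}
    (hδ : ∀ H : Subgroup Γ, H.Normal → ∀ u, IsInvariant H u → IsInvariant H (δ u))
    (he : IsControlled δ e) (w : Γ) : IsControlled δ fun u g => e u (g * w) := by
  classical
  obtain ⟨K, hK, he⟩ := he
  refine ⟨K, hK, fun H hH C hC u hu => ?_⟩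
  have h := he H hH _ (hC.image_mul_right hH w) u hu
  rw [Finset.sum_image (fun a _ b _ h => mul_right_cancel h),
    Finset.sum_image (fun a _ b _ h => mul_right_cancel h)] at h
  have h2 : IsInvariant H fun g => δ u g ^ 2 := fun g t ht => by
    simp only [hδ H hH u hu g t ht]
  rwa [hC.sum_mul_right hH h2 w] at h

/-- A discrete Korn inequality for two commuting shifts: the symmetrized differences control the
mixed differences. -/
theorem korn {s t : Γ} (hst : Commute s t) {p q : (Γ → X) → Γ → ℝ}
    (hp : ∀ H : Subgroup Γ, H.Normal → ∀ u, IsInvariant H u → IsInvariant H (p u))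
    (hq : ∀ H : Subgroup Γ, H.Normal → ∀ u, IsInvariant H u → IsInvariant H (q u))
    (hqs : IsControlled δ fun u g => q u (g * s) - q u g)
    (hpt : IsControlled δ fun u g => p u (g * t) - p u g)
    (hpq : IsControlled δ fun u g => (p u (g * s) - p u g) + (q u (g * t) - q u g)) :
    IsControlled δ fun u g => p u (g * s) - p u g := by
  obtain ⟨K₁, hK₁, h₁⟩ := hqs
  obtain ⟨K₂, hK₂, h₂⟩ := hpt
  obtain ⟨K₃, hK₃, h₃⟩ := hpq
  refine ⟨K₁ + K₂ + K₃, by positivity, fun H hH C hC u hu => ?_⟩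
  specialize h₁ H hH C hC u hu
  specialize h₂ H hH C hC u hu
  specialize h₃ H hH C hC u hu
  simp only [Real.norm_eq_abs, sq_abs] at h₁ h₂ h₃ ⊢
  replace hp := hp H hH u hu
  replace hq := hq H hH u hu
  generalize p u = p at *
  generalize q u = q at *
  have hps := hp.comp_mul_right hH s
  have hpt := hp.comp_mul_right hH t
  have hqs := hq.comp_mul_right hH s
  have hqt := hq.comp_mul_right hH t
  have shift : ∀ φ : Γ → ℝ, IsInvariant H φ → ∀ w, ∑ g ∈ C, φ (g * w) = ∑ g ∈ C, φ g :=
    fun φ hφ w => hC.sum_mul_right hH hφ w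
  have e₁ := shift (fun g => (q (g * s) - q g) ^ 2)
    (fun g a ha => by have := hqs g a ha; have := hq g a ha; simp_all) t
  have e₂ := shift (fun g => (p (g * t) - p g) ^ 2)
    (fun g a ha => by have := hpt g a ha; have := hp g a ha; simp_all) s
  have e₃ := shift (fun g => p g * q g)
    (fun g a ha => by have := hq g a ha; have := hp g a ha; simp_all) (s * t)
  have e₄ := shift (fun g => p (g * s) * q g)
    (fun g a ha => by have := hps g a ha; have := hq g a ha; simp_all) t
  have e₅ := shift (fun g => p g * q (g * t))
    (fun g a ha => by have := hp g a ha; have := hqt g a ha; simp_all) s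
  have hts : ∀ g, g * t * s = g * (s * t) := fun g => by rw [hst.eq, mul_assoc]
  have hst' : ∀ g, g * s * t = g * (s * t) := fun g => mul_assoc _ _ _
  simp only [hts, hst'] at e₁ e₂ e₄ e₅
  -- Discrete integration by parts: the product of mixed differences becomes a product of the pure
  -- differences, of `p` along `t` and of `q` along `s`.
  have key : ∑ g ∈ C, (p (g * s) - p g) * (q (g * t) - q g)
      = ∑ g ∈ C, (p (g * (s * t)) - p (g * s)) * (q (g * (s * t)) - q (g * t)) := by
    simp only [sub_mul, mul_sub, Finset.sum_sub_distrib]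
    linarith
  have hle : ∑ g ∈ C, (p (g * s) - p g) ^ 2
      ≤ ∑ g ∈ C, ((p (g * s) - p g) + (q (g * t) - q g)) ^ 2
        - 2 * ∑ g ∈ C, (p (g * s) - p g) * (q (g * t) - q g) := by
    rw [Finset.mul_sum, ← Finset.sum_sub_distrib]
    refine Finset.sum_le_sum fun g _ => ?_
    nlinarith [sq_nonneg (q (g * t) - q g)]
  have hle' : -(2 * ∑ g ∈ C, (p (g * (s * t)) - p (g * s)) * (q (g * (s * t)) - q (g * t)))
      ≤ ∑ g ∈ C, (p (g * (s * t)) - p (g * s)) ^ 2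
        + ∑ g ∈ C, (q (g * (s * t)) - q (g * t)) ^ 2 := by
    rw [Finset.mul_sum, ← Finset.sum_neg_distrib, ← Finset.sum_add_distrib]
    refine Finset.sum_le_sum fun g _ => ?_
    nlinarith [sq_nonneg ((p (g * (s * t)) - p (g * s)) + (q (g * (s * t)) - q (g * t)))]
  rw [add_mul, add_mul]
  linarith

end IsControlled

end Controlled

/-- A linear isometry `A` satisfies `(A - 1) q(A) = 0` for a polynomial `q` with `q(1) ≠ 0`. -/
theorem exists_polynomial_of_isometry {V : Type*} [NormedAddCommGroup V] [InnerProductSpace ℝ V]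
    [FiniteDimensional ℝ V] (A : V →ₗᵢ[ℝ] V) :
    ∃ q : Polynomial ℝ, q.eval 1 ≠ 0 ∧
      ∀ x, A (Polynomial.aeval A.toLinearMap q x) = Polynomial.aeval A.toLinearMap q x := by
  -- An isometry has no Jordan block at the eigenvalue 1: if `y = A x - x` is fixed, then `⟨y, y⟩ =
  -- ⟨A x, A y⟩ - ⟨x, y⟩ = 0`. Hence `q` can be the minimal polynomial with all factors `X - 1`
  -- removed.
  have hsq : ∀ x, A (A x - x) = A x - x → A x = x := by
    intro x hx
    have h : inner ℝ (A x - x) (A x - x) = 0 := by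
      rw [inner_sub_left]
      nth_rewrite 1 [← hx]
      rw [A.inner_map_map, sub_self]
    exact sub_eq_zero.mp (inner_self_eq_zero.mp h)
  have hpow : ∀ k : ℕ, ∀ x, ((A.toLinearMap - 1 : Module.End ℝ V) ^ k) x = 0 → A x = x := by
    intro k
    induction k with
    | zero => intro x hx; simp at hx; simp [hx]
    | succ k ih =>
      intro x hx
      rw [pow_succ] at hx
      exact hsq x (ih _ hx)
  have h0 : minpoly ℝ A.toLinearMap ≠ 0 := minpoly.ne_zero (Algebra.IsIntegral.isIntegral _)
  obtain ⟨q, hq, hnd⟩ := Polynomial.exists_eq_pow_rootMultiplicity_mul_and_not_dvd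
    (minpoly ℝ A.toLinearMap) h0 1
  refine ⟨q, fun h => hnd (Polynomial.dvd_iff_isRoot.mpr h), fun x => ?_⟩
  refine hpow ((minpoly ℝ A.toLinearMap).rootMultiplicity 1) _ ?_
  have := minpoly.aeval ℝ A.toLinearMap
  rw [hq] at this
  simp only [map_mul, map_pow, map_sub, Polynomial.aeval_X, map_one] at this
  exact DFunLike.congr_fun this x

end ObjectiveStructure

namespace ObjectiveStructure

noncomputable section

/-! ### Local affine approximations and their propagation along the group -/

section LocalRigidity

variable {d₁ d₂ : ℕ} {G : Subgroup (EuclideanGroup (Fin d₁ ⊕ Fin d₂))}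

theorem rot_mul_apply {ι : Type} [Fintype ι] (g h : EuclideanGroup ι) (z : EuclideanSpace ℝ ι) :
    rot (g * h) z = rot g (rot h z) := rfl

theorem rot_inv_apply_rot {ι : Type} [Fintype ι] (g : EuclideanGroup ι)
    (z : EuclideanSpace ℝ ι) : rot g⁻¹ (rot g z) = z := by
  rw [← rot_mul_apply, inv_mul_cancel]
  rfl

theorem act_mul (g h : G) (z : Space d₁ d₂) : act (g * h) z = act g (act h z) := rfl

theorem act_one (z : Space d₁ d₂) : act (1 : G) z = z := rfl

/-- The distance of `u(g ·)|_R` to the infinitesimal isometries. -/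
def localDefect (x₀ : Space d₁ d₂) (R : Finset G) (u : G → Space d₁ d₂) (g : G) : ℝ :=
  ‖(isoSpace x₀ R)ᗮ.starProjection (patch R u g)‖

theorem IsInvariant.patch {H : Subgroup G} (hH : H.Normal) {u : G → Space d₁ d₂}
    (hu : IsInvariant H u) (R : Finset G) : IsInvariant H (patch R u) := by
  intro g t ht
  refine congrArg (WithLp.toLp 2) (funext fun h => ?_)
  exact hu.comp_mul_right hH h g t ht

theorem IsInvariant.localDefect {x₀ : Space d₁ d₂} {R : Finset G} (H : Subgroup G) (hH : H.Normal)
    (u : G → Space d₁ d₂) (hu : IsInvariant H u) : IsInvariant H (localDefect x₀ R u) := by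
  intro g t ht
  simp only [ObjectiveStructure.localDefect, hu.patch hH R g t ht]

theorem norm_starProjection_orthogonal_le {V : Type*} [NormedAddCommGroup V]
    [InnerProductSpace ℝ V] [FiniteDimensional ℝ V] (U : Submodule ℝ V) (x : V) {w : V}
    (hw : w ∈ U) : ‖Uᗮ.starProjection x‖ ≤ ‖x - w‖ := by
  have h : Uᗮ.starProjection w = 0 := by
    rw [Submodule.starProjection_apply_eq_zero_iff]
    exact Submodule.le_orthogonal_orthogonal U hw
  calc ‖Uᗮ.starProjection x‖ = ‖Uᗮ.starProjection (x - w)‖ := by rw [map_sub, h, sub_zero]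
    _ ≤ ‖x - w‖ := Submodule.norm_starProjection_apply_le _ _

/-- The affine map `z ↦ a + A (z - x₀)`. -/
def affineField (x₀ a : Space d₁ d₂) (A : Matrix (Fin d₁ ⊕ Fin d₂) (Fin d₁ ⊕ Fin d₂) ℝ) :
    Space d₁ d₂ →ᵃ[ℝ] Space d₁ d₂ where
  toFun z := a + Matrix.toEuclideanLin A (z - x₀)
  linear := Matrix.toEuclideanLin A
  map_vadd' p v := by
    simp only [vadd_eq_add, map_sub, map_add]
    abel

theorem exists_skew_approximation (x₀ : Space d₁ d₂) (R : Finset G) (u : G → Space d₁ d₂) (g : G) :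
    ∃ a : Space d₁ d₂, ∃ A ∈ skew (Fin d₁ ⊕ Fin d₂), ∀ h ∈ R,
      ‖rot (h : EuclideanGroup (Fin d₁ ⊕ Fin d₂)) (u (g * h)) - affineField x₀ a A (act h x₀)‖
        ≤ localDefect x₀ R u g := by
  obtain ⟨w₁, ⟨a, ha⟩, w₂, ⟨A, hA, hw₂⟩, hw⟩ := Submodule.mem_sup.mp
    ((isoSpace x₀ R).starProjection_apply_mem (patch R u g))
  refine ⟨a, A, hA, fun h hh => ?_⟩
  have heq : (isoSpace x₀ R)ᗮ.starProjection (patch R u g)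
      = patch R u g - (w₁ + w₂) := by
    rw [hw, Submodule.starProjection_orthogonal_val]
  have hle := PiLp.norm_apply_le (patch R u g - (w₁ + w₂)) (⟨h, hh⟩ : R)
  rw [← heq] at hle
  refine le_trans (le_of_eq ?_) hle
  rw [heq]
  refine Eq.trans ?_ ((rot (h : EuclideanGroup (Fin d₁ ⊕ Fin d₂))).norm_map _)
  congr 1
  rw [PiLp.sub_apply, PiLp.add_apply, map_sub, map_add]
  have h₁ := ha ⟨h, hh⟩
  have h₂ := hw₂ ⟨h, hh⟩
  simp only at h₁ h₂
  rw [h₁, h₂]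
  rfl

variable {x₀ : Space d₁ d₂} {R : Finset G}
  {ℓ : (G → Space d₁ d₂) → G → Space d₁ d₂ →ᵃ[ℝ] Space d₁ d₂}

theorem isControlled_affine_combination
    {L : (G → Space d₁ d₂) → G → Space d₁ d₂ →ᵃ[ℝ] Space d₁ d₂}
    {δ : (G → Space d₁ d₂) → G → ℝ} {A : Set (Space d₁ d₂)}
    (hA : ∀ z ∈ A, IsControlled δ fun u g => L u g z) {z : Space d₁ d₂}
    (hz : z ∈ affineSpan ℝ A) : IsControlled δ fun u g => L u g z := by
  refine affineSpan_induction (p := fun z => IsControlled δ fun u g => L u g z) hz hA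
    fun c x y z hx hy hz => ?_
  refine ((hx.sub hy).const_smul c).add hz |>.mono 1 fun u g => ?_
  rw [one_mul, AffineMap.map_vadd, map_smul, AffineMap.linearMap_vsub]
  rfl

/-- The affine map `z ↦ L₁ (w z) - rot(w) (L₂ z)`. -/
def frameChange (w : EuclideanGroup (Fin d₁ ⊕ Fin d₂))
    (L₁ L₂ : Space d₁ d₂ →ᵃ[ℝ] Space d₁ d₂) : Space d₁ d₂ →ᵃ[ℝ] Space d₁ d₂ :=
  L₁.comp w.toAffineEquiv.toAffineMap
    - (rot w).toLinearEquiv.toLinearMap.toAffineMap.comp L₂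

theorem frameChange_apply (w : EuclideanGroup (Fin d₁ ⊕ Fin d₂))
    (L₁ L₂ : Space d₁ d₂ →ᵃ[ℝ] Space d₁ d₂) (z : Space d₁ d₂) :
    frameChange w L₁ L₂ z = L₁ (w z) - rot w (L₂ z) := rfl

theorem isControlled_frameChange (hR : HasProperty2 x₀ R)
    (hℓ : ∀ u g, ∀ h ∈ R,
      ‖rot (h : EuclideanGroup (Fin d₁ ⊕ Fin d₂)) (u (g * h)) - ℓ u g (act h x₀)‖
        ≤ localDefect x₀ R u g) (w : G) :
    ∀ k : G, IsControlled (localDefect x₀ R)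
      fun u g => frameChange w (ℓ u g) (ℓ u (g * w)) (act k x₀) := by
  obtain ⟨R', R'', hR'1, hR', ⟨-, hR''1, hspan⟩, hsub⟩ := hR
  have hw : w ∈ Subgroup.closure R' := hR' ▸ Subgroup.mem_top w
  have hδ := IsInvariant.localDefect (x₀ := x₀) (R := R)
  induction hw using Subgroup.closure_induction with
  | mem r hr =>
    -- On a generator both `r h` and `h = 1 h` lie in `R` for `h ∈ R''`, so the two fields are
    -- compared through the same value of `u`; affinity then reaches every point `k x₀`.
    intro k
    have hk : act k x₀ ∈ affineSpan ℝ ((fun g : G => act g x₀) '' R'') :=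
      hspan ▸ subset_affineSpan ℝ _ ⟨k, rfl⟩
    refine isControlled_affine_combination (L := fun u g => frameChange r (ℓ u g) (ℓ u (g * r)))
      ?_ hk
    rintro _ ⟨h, hh, rfl⟩
    have hrh : r * h ∈ R := hsub r hr h hh
    have hhR : h ∈ R := by simpa using hsub 1 hR'1 h hh
    have h₁ := IsControlled.of_norm_le (δ := localDefect x₀ R) (fun u g => hℓ u g _ hrh)
    have h₂ := (IsControlled.of_norm_le (δ := localDefect x₀ R)
      (fun u g => hℓ u g _ hhR)).shift hδ r
    refine (h₂.map (rot (r : EuclideanGroup (Fin d₁ ⊕ Fin d₂)) :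
      Space d₁ d₂ →L[ℝ] Space d₁ d₂)).sub h₁ |>.mono 1 fun u g => le_of_eq ?_
    rw [one_mul]
    congr 1
    rw [frameChange_apply, Subgroup.coe_mul, rot_mul_apply, ← mul_assoc]
    simp only [ContinuousLinearEquiv.coe_coe, LinearIsometryEquiv.coe_toContinuousLinearEquiv,
      map_sub]
    rw [act_mul]
    simp only [act]
    abel
  | one =>
    intro k
    refine IsControlled.zero (E := Space d₁ d₂) |>.mono 1 fun u g => ?_
    have hone : frameChange ((1 : G) : EuclideanGroup (Fin d₁ ⊕ Fin d₂)) (ℓ u g) (ℓ u (g * 1))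
        (act k x₀) = ℓ u g (act k x₀) - ℓ u (g * 1) (act k x₀) := rfl
    rw [hone, mul_one, sub_self, one_mul]
  | mul w₁ w₂ _ _ ih₁ ih₂ =>
    -- Cocycle identity: the mismatch for `w₁ w₂` at `z` is that for `w₁` at `w₂ z` plus the
    -- rotated, shifted mismatch for `w₂`. This is why all base points `k x₀` are carried through
    -- the induction.
    intro k
    refine (ih₁ (w₂ * k)).add (((ih₂ k).shift hδ w₁).map
      (rot (w₁ : EuclideanGroup (Fin d₁ ⊕ Fin d₂)) : Space d₁ d₂ →L[ℝ] Space d₁ d₂))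
      |>.mono 1 fun u g => le_of_eq ?_
    rw [one_mul]
    congr 1
    simp only [frameChange_apply, ContinuousLinearEquiv.coe_coe,
      LinearIsometryEquiv.coe_toContinuousLinearEquiv, map_sub, Subgroup.coe_mul, rot_mul_apply,
      mul_assoc, act_mul]
    simp only [act, AffineIsometryEquiv.coe_mul, Function.comp]
    abel
  | inv w _ ih =>
    intro k
    refine ((ih (w⁻¹ * k)).shift hδ w⁻¹).map
      (rot ((w⁻¹ : G) : EuclideanGroup (Fin d₁ ⊕ Fin d₂)) : Space d₁ d₂ →L[ℝ] Space d₁ d₂)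
      |>.mono 1 fun u g => le_of_eq ?_
    rw [one_mul, ← norm_neg]
    congr 1
    have hact : (w : EuclideanGroup (Fin d₁ ⊕ Fin d₂)) (act (w⁻¹ * k) x₀) = act k x₀ := by
      change act w (act (w⁻¹ * k) x₀) = _
      rw [← act_mul, mul_inv_cancel_left]
    simp only [frameChange_apply, ContinuousLinearEquiv.coe_coe, hact,
      LinearIsometryEquiv.coe_toContinuousLinearEquiv, map_sub, inv_mul_cancel_right,
      Subgroup.coe_inv, rot_inv_apply_rot]
    simp only [act, Subgroup.coe_mul, AffineIsometryEquiv.coe_mul, Function.comp, Subgroup.coe_inv]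
    abel

/-- The local approximation extends from the patch `R` to all of `G`. -/
theorem isControlled_sub_affineField (hR : HasProperty2 x₀ R)
    (hℓ : ∀ u g, ∀ h ∈ R,
      ‖rot (h : EuclideanGroup (Fin d₁ ⊕ Fin d₂)) (u (g * h)) - ℓ u g (act h x₀)‖
        ≤ localDefect x₀ R u g) (w : G) :
    IsControlled (localDefect x₀ R) fun u g =>
      rot (w : EuclideanGroup (Fin d₁ ⊕ Fin d₂)) (u (g * w)) - ℓ u g (act w x₀) := by
  have h1 : (1 : G) ∈ R := by
    obtain ⟨R', R'', hR'1, -, ⟨-, hR''1, -⟩, hsub⟩ := hR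
    simpa using hsub 1 hR'1 1 hR''1
  have h₁ := (IsControlled.of_norm_le (δ := localDefect x₀ R)
      (fun u g => hℓ u g _ h1)).shift IsInvariant.localDefect w
  refine (h₁.map (rot (w : EuclideanGroup (Fin d₁ ⊕ Fin d₂)) :
      Space d₁ d₂ →L[ℝ] Space d₁ d₂)).sub (isControlled_frameChange hR hℓ w 1)
      |>.mono 1 fun u g => le_of_eq ?_
  rw [one_mul]
  congr 1
  have hone : ∀ z : Space d₁ d₂, rot ((1 : G) : EuclideanGroup (Fin d₁ ⊕ Fin d₂)) z = z :=
    fun _ => rfl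
  simp only [frameChange_apply, ContinuousLinearEquiv.coe_coe, mul_one, act_one, hone,
      LinearIsometryEquiv.coe_toContinuousLinearEquiv, map_sub]
  simp only [act]
  abel

end LocalRigidity

end

end ObjectiveStructure

namespace ObjectiveStructure

noncomputable section

open Polynomial

theorem IsControlled.piLp {Γ X : Type} [Group Γ] {δ : (Γ → X) → Γ → ℝ} {ι : Type*} [Fintype ι]
    {E : ι → Type*} [∀ i, NormedAddCommGroup (E i)] {e : (Γ → X) → Γ → PiLp 2 E}
    (he : ∀ i, IsControlled δ fun u g => e u g i) : IsControlled δ e := by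
  refine (IsControlled.sum (E := ℝ) Finset.univ (e := fun i u g => ‖e u g i‖) fun i _ =>
    (he i).mono 1 fun u g => by simp) |>.mono 1 fun u g => ?_
  have h0 : 0 ≤ ∑ i, ‖e u g i‖ := Finset.sum_nonneg fun _ _ => norm_nonneg _
  rw [one_mul, Real.norm_of_nonneg h0, PiLp.norm_eq_of_L2]
  exact Real.sqrt_le_iff.mpr ⟨h0, Finset.sum_sq_le_sq_sum_of_nonneg fun _ _ => norm_nonneg _⟩

/-! ### Commuting screw motions: filtering out rotations and applying Korn -/

section Screw

variable {d₁ d₂ : ℕ} {G : Subgroup (EuclideanGroup (Fin d₁ ⊕ Fin d₂))}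

/-- The linear part of `g`, as an endomorphism. -/
def rotEnd (g : G) : Module.End ℝ (Space d₁ d₂) :=
  (rot (g : EuclideanGroup (Fin d₁ ⊕ Fin d₂))).toLinearIsometry.toLinearMap

theorem rotEnd_apply (g : G) (z : Space d₁ d₂) :
    rotEnd g z = rot (g : EuclideanGroup (Fin d₁ ⊕ Fin d₂)) z := rfl

theorem rotEnd_mul (g h : G) : rotEnd (g * h) = rotEnd g * rotEnd h := rfl

theorem rotEnd_one : rotEnd (1 : G) = 1 := rfl

theorem rotEnd_pow (g : G) (n : ℕ) : rotEnd (g ^ n) = rotEnd g ^ n := by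
  induction n with
  | zero => exact rotEnd_one
  | succ n ih => rw [pow_succ, pow_succ, rotEnd_mul, ih]

theorem rotEnd_pow_apply_fixed {g : G} {c : Space d₁ d₂} (h : rotEnd g c = c) (n : ℕ) :
    (rotEnd g ^ n) c = c := by
  induction n with
  | zero => rfl
  | succ n ih => rw [pow_succ, Module.End.mul_apply, h, ih]

theorem act_pow {s : G} {c : Space d₁ d₂} (hs : ∀ z, act s z = rotEnd s z + c)
    (hc : rotEnd s c = c) (n : ℕ) (z : Space d₁ d₂) :
    act (s ^ n) z = (rotEnd s ^ n) z + (n : ℝ) • c := by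
  induction n with
  | zero => rw [pow_zero, act_one]; simp
  | succ n ih =>
    rw [pow_succ', act_mul, hs, ih, map_add, map_smul, hc, pow_succ', Module.End.mul_apply]
    push_cast
    module

/-- If `(A - 1) q(A) = 0` for the linear part `A` of `s`, then the average with weights `q`
removes the rotational part of `s`. -/
theorem sum_coeff_smul_act_sub {s t : G} {c c' : Space d₁ d₂}
    (hs : ∀ z, act s z = rotEnd s z + c) (ht : ∀ z, act t z = rotEnd t z + c')
    (hsc : rotEnd s c = c) (hsc' : rotEnd s c' = c') (htc' : rotEnd t c' = c') {q r : ℝ[X]}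
    (hq : ∀ x, rotEnd s (aeval (rotEnd s) q x) = aeval (rotEnd s) q x) (z : Space d₁ d₂) :
    ∑ m ∈ Finset.range (q.natDegree + 1), ∑ n ∈ Finset.range (r.natDegree + 1),
      (q.coeff m * r.coeff n) • (act (s ^ (m + 1) * t ^ n) z - act (s ^ m * t ^ n) z)
      = (q.eval 1 * r.eval 1) • c := by
  have hact : ∀ m n : ℕ, act (s ^ m * t ^ n) z
      = (rotEnd s ^ m) ((rotEnd t ^ n) z) + (n : ℝ) • c' + (m : ℝ) • c := by
    intro m n
    rw [act_mul, act_pow hs hsc, act_pow ht htc', map_add, map_smul, rotEnd_pow_apply_fixed hsc']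
  have hdiff : ∀ m n : ℕ, act (s ^ (m + 1) * t ^ n) z - act (s ^ m * t ^ n) z
      = rotEnd s ((rotEnd s ^ m) ((rotEnd t ^ n) z)) - (rotEnd s ^ m) ((rotEnd t ^ n) z) + c := by
    intro m n
    rw [hact, hact, pow_succ', Module.End.mul_apply]
    push_cast
    module
  have hP : ∑ m ∈ Finset.range (q.natDegree + 1), ∑ n ∈ Finset.range (r.natDegree + 1),
      (q.coeff m * r.coeff n) • (rotEnd s ^ m) ((rotEnd t ^ n) z)
      = aeval (rotEnd s) q (aeval (rotEnd t) r z) := by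
    rw [aeval_eq_sum_range, aeval_eq_sum_range]
    simp only [LinearMap.sum_apply, LinearMap.smul_apply, map_sum, map_smul, Finset.smul_sum,
      smul_smul]
    simp only [mul_comm]
    exact Finset.sum_comm
  simp only [hdiff, smul_add, smul_sub, Finset.sum_add_distrib, Finset.sum_sub_distrib]
  -- The rotating part sums to `(A - 1) q(A) r(B) z = 0`, with `A`, `B` the linear parts of `s`,
  -- `t`; the remaining copies of `c` have total weight `q(1) r(1)`.
  rw [hP]
  have hP' := congrArg (rotEnd s) hP
  simp only [map_sum, map_smul] at hP'
  rw [hP', hq, sub_self, zero_add, eval_eq_sum_range, eval_eq_sum_range, Finset.sum_mul_sum]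
  simp only [one_pow, mul_one, Finset.sum_smul]

/-- The average of the component of `u` along `c` over the points `g s^m t^n`, with the
coefficients of two polynomials as weights. -/
def filtered (s t : G) (q r : ℝ[X]) (c : Space d₁ d₂) (u : G → Space d₁ d₂) (g : G) : ℝ :=
  ∑ m ∈ Finset.range (q.natDegree + 1), ∑ n ∈ Finset.range (r.natDegree + 1),
    (q.coeff m * r.coeff n) * inner ℝ c (u (g * (s ^ m * t ^ n)))

theorem filtered_swap {s t : G} (hst : Commute s t) (q r : ℝ[X]) (c : Space d₁ d₂) :
    filtered t s r q c = filtered s t q r c := by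
  funext u g
  unfold filtered
  rw [Finset.sum_comm]
  refine Finset.sum_congr rfl fun m _ => Finset.sum_congr rfl fun n _ => ?_
  rw [(hst.pow_pow m n).eq, mul_comm (q.coeff m)]

theorem IsInvariant.filtered (s t : G) (q r : ℝ[X]) (c : Space d₁ d₂) (H : Subgroup G)
    (hH : H.Normal) (u : G → Space d₁ d₂) (hu : IsInvariant H u) :
    IsInvariant H (filtered s t q r c u) := by
  intro g a ha
  refine Finset.sum_congr rfl fun m _ => Finset.sum_congr rfl fun n _ => ?_
  have h := hu.comp_mul_right hH (s ^ m * t ^ n) g a ha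
  simp only at h
  rw [h]

variable {δ : (G → Space d₁ d₂) → G → ℝ} {x₀ : Space d₁ d₂}
  {ℓ : (G → Space d₁ d₂) → G → Space d₁ d₂ →ᵃ[ℝ] Space d₁ d₂}

/-- Since `b` is fixed by all the linear parts, `⟨b, u(g w)⟩ = ⟨b, rot(w) u(g w)⟩`, which is `⟨b,
ℓ(g)(w x₀)⟩` up to a controlled error. The weights then leave only the translation `c` in the
difference along `s`. -/
theorem isControlled_filtered_sub
    (hℓ : ∀ w : G, IsControlled δ fun u g =>
      rot (w : EuclideanGroup (Fin d₁ ⊕ Fin d₂)) (u (g * w)) - ℓ u g (act w x₀))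
    {s t : G} {c c' : Space d₁ d₂}
    (hs : ∀ z, act s z = rotEnd s z + c) (ht : ∀ z, act t z = rotEnd t z + c')
    (hsc : rotEnd s c = c) (hsc' : rotEnd s c' = c') (htc' : rotEnd t c' = c') {q r : ℝ[X]}
    (hq : ∀ x, rotEnd s (aeval (rotEnd s) q x) = aeval (rotEnd s) q x) {b : Space d₁ d₂}
    (hsb : rotEnd s b = b) (htb : rotEnd t b = b) :
    IsControlled δ fun u g => filtered s t q r b u (g * s) - filtered s t q r b u g
      - (q.eval 1 * r.eval 1) * inner ℝ b ((ℓ u g).linear c) := by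
  have hrot : ∀ m n : ℕ, rotEnd (s ^ m * t ^ n) b = b := by
    intro m n
    rw [rotEnd_mul, Module.End.mul_apply, rotEnd_pow, rotEnd_pow, rotEnd_pow_apply_fixed htb,
      rotEnd_pow_apply_fixed hsb]
  have hterm : ∀ m n : ℕ, IsControlled δ fun u g =>
      inner ℝ b (u (g * (s ^ m * t ^ n))) - inner ℝ b (ℓ u g (act (s ^ m * t ^ n) x₀)) := by
    intro m n
    refine (hℓ (s ^ m * t ^ n)).map (innerSL ℝ b) |>.mono 1 fun u g => le_of_eq ?_
    rw [one_mul]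
    congr 1
    rw [map_sub, innerSL_apply_apply, innerSL_apply_apply]
    nth_rewrite 3 [← hrot m n]
    rw [rotEnd_apply, LinearIsometryEquiv.inner_map_map]
  have hsum := IsControlled.sum (Finset.range (q.natDegree + 1)) fun m _ =>
    IsControlled.sum (Finset.range (r.natDegree + 1)) fun n _ =>
      ((hterm (m + 1) n).sub (hterm m n)).const_smul (q.coeff m * r.coeff n)
  refine hsum.mono 1 fun u g => le_of_eq ?_
  rw [one_mul]
  congr 1
  have key := congrArg (fun z => inner ℝ b ((ℓ u g).linear z))
    (sum_coeff_smul_act_sub hs ht hsc hsc' htc' (r := r) hq x₀)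
  simp only [map_sum, map_smul, inner_sum, inner_smul_right, map_sub] at key
  rw [← key]
  unfold filtered
  simp only [← Finset.sum_sub_distrib]
  refine Finset.sum_congr rfl fun m _ => Finset.sum_congr rfl fun n _ => ?_
  rw [← map_sub, ← vsub_eq_sub (act (s ^ (m + 1) * t ^ n) x₀), AffineMap.linearMap_vsub,
    vsub_eq_sub, inner_sub_right, smul_eq_mul, mul_assoc g s, ← mul_assoc s, ← pow_succ']
  ring

theorem isControlled_inner_linear
    (hℓ : ∀ w : G, IsControlled δ fun u g =>
      rot (w : EuclideanGroup (Fin d₁ ⊕ Fin d₂)) (u (g * w)) - ℓ u g (act w x₀))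
    (hskew : ∀ u g x y, inner ℝ x ((ℓ u g).linear y) = -inner ℝ y ((ℓ u g).linear x))
    {s t : G} (hst : Commute s t) {c c' : Space d₁ d₂}
    (hs : ∀ z, act s z = rotEnd s z + c) (ht : ∀ z, act t z = rotEnd t z + c')
    (hsc : rotEnd s c = c) (hsc' : rotEnd s c' = c') (htc : rotEnd t c = c)
    (htc' : rotEnd t c' = c') :
    IsControlled δ fun u g => inner ℝ c' ((ℓ u g).linear c) := by
  obtain ⟨q, hq1, hq⟩ := exists_polynomial_of_isometry
    (rot (s : EuclideanGroup (Fin d₁ ⊕ Fin d₂))).toLinearIsometry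
  obtain ⟨r, hr1, hr⟩ := exists_polynomial_of_isometry
    (rot (t : EuclideanGroup (Fin d₁ ⊕ Fin d₂))).toLinearIsometry
  have hself : ∀ u g x, inner ℝ x ((ℓ u g).linear x) = 0 := fun u g x => by
    linarith [hskew u g x x]
  -- Both weights are kept in every filter so that the same two functions can be differenced along
  -- `s` and along `t`.
  have hps := isControlled_filtered_sub hℓ hs ht hsc hsc' htc' (r := r) hq hsc' htc'
  have hqs := isControlled_filtered_sub hℓ hs ht hsc hsc' htc' (r := r) hq hsc htc
  have hpt := isControlled_filtered_sub hℓ ht hs htc' htc hsc (r := q) hr htc' hsc'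
  have hqt := isControlled_filtered_sub hℓ ht hs htc' htc hsc (r := q) hr htc hsc
  simp only [filtered_swap hst, hself, mul_zero, sub_zero] at hqs hpt hqt
  have hmix := IsControlled.korn hst (IsInvariant.filtered s t q r c')
    (IsInvariant.filtered s t q r c) hqs hpt ((hps.add hqt).mono 1 fun u g => le_of_eq (by
      rw [one_mul, hskew u g c c']
      congr 1
      ring))
  refine (hmix.sub hps).const_smul (q.eval 1 * r.eval 1)⁻¹ |>.mono 1 fun u g => le_of_eq ?_
  have h0 : q.eval 1 * r.eval 1 ≠ 0 := mul_ne_zero hq1 hr1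
  rw [one_mul, sub_sub_cancel, smul_eq_mul, inv_mul_cancel_left₀ h0]

end Screw

end

end ObjectiveStructure

namespace ObjectiveStructure

noncomputable section

/-! ### Group elements projecting to translations -/

section Translations

variable {d₁ d₂ : ℕ}

theorem join_add (x x' : EuclideanSpace ℝ (Fin d₁)) (y y' : EuclideanSpace ℝ (Fin d₂)) :
    join x y + join x' y' = join (x + x') (y + y') := by
  ext (i | j) <;> rfl

theorem join_right_injective (x : EuclideanSpace ℝ (Fin d₁)) :
    Function.Injective fun y : EuclideanSpace ℝ (Fin d₂) => join x y := by
  intro y y' h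
  ext j
  exact congrArg (fun z : Space d₁ d₂ => z (Sum.inr j)) h

/-- The embedding `y ↦ (0, y)`. -/
def joinZero (d₁ d₂ : ℕ) : EuclideanSpace ℝ (Fin d₂) →ₗ[ℝ] Space d₁ d₂ where
  toFun y := join 0 y
  map_add' y y' := by rw [join_add, add_zero]
  map_smul' r y := by ext (i | j) <;> simp [join]

theorem joinZero_apply (y : EuclideanSpace ℝ (Fin d₂)) : joinZero d₁ d₂ y = join 0 y := rfl

theorem apply_eq_rot_add {ι : Type} [Fintype ι] (g : EuclideanGroup ι) (z : EuclideanSpace ℝ ι) :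
    g z = rot g z + g 0 := by
  have h := g.map_vsub z 0
  rw [vsub_eq_sub, vsub_eq_sub, sub_zero] at h
  exact eq_add_of_sub_eq h.symm

variable {g h : EuclideanGroup (Fin d₁ ⊕ Fin d₂)} {v w : EuclideanSpace ℝ (Fin d₂)}

theorem ProjectsTo.zero_apply (hg : ProjectsTo g (translation v)) :
    g 0 = joinZero d₁ d₂ v := by
  obtain ⟨A, hA⟩ := hg
  have h := hA 0 0
  rw [map_zero, ← joinZero_apply, map_zero] at h
  rw [h, joinZero_apply]
  congr 1
  exact add_zero v

theorem ProjectsTo.rot_joinZero (hg : ProjectsTo g (translation v))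
    (y : EuclideanSpace ℝ (Fin d₂)) : rot g (joinZero d₁ d₂ y) = joinZero d₁ d₂ y := by
  have h0 := hg.zero_apply
  obtain ⟨A, hA⟩ := hg
  have h := hA 0 y
  rw [map_zero, ← joinZero_apply, apply_eq_rot_add, h0] at h
  refine add_right_cancel (h.trans ?_)
  rw [← map_add, joinZero_apply, add_comm y v]
  rfl

theorem ProjectsTo.eq_of_translation (hg : ProjectsTo g (translation v))
    (hg' : ProjectsTo g (translation w)) : v = w :=
  join_right_injective 0 (hg.zero_apply.symm.trans hg'.zero_apply)

theorem ProjectsTo.mul {s s' : EuclideanGroup (Fin d₂)} (hg : ProjectsTo g s)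
    (hh : ProjectsTo h s') : ProjectsTo (g * h) (s * s') := by
  obtain ⟨A, hA⟩ := hg
  obtain ⟨B, hB⟩ := hh
  refine ⟨A * B, fun x y => ?_⟩
  change g (h (join x y)) = _
  rw [hB, hA]
  rfl

theorem translation_mul (v w : EuclideanSpace ℝ (Fin d₂)) :
    translation v * translation w = translation (v + w) := by
  ext1 y
  exact (add_assoc v w y).symm

theorem ProjectsTo.mul_translation (hg : ProjectsTo g (translation v))
    (hh : ProjectsTo h (translation w)) : ProjectsTo (g * h) (translation (v + w)) :=
  translation_mul v w ▸ hg.mul hh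

theorem ProjectsTo.pow_translation (hg : ProjectsTo g (translation v)) (n : ℕ) :
    ProjectsTo (g ^ n) (translation ((n : ℝ) • v)) := by
  induction n with
  | zero =>
    refine ⟨1, fun x y => ?_⟩
    change join x y = join x (((0 : ℕ) : ℝ) • v + y)
    simp
  | succ n ih =>
    have h := ih.mul_translation hg
    rw [← pow_succ] at h
    convert h using 2
    push_cast
    module

/-- The elements of `T^N` commute if they form a group. -/
theorem IsTranslationSection.commute_of_mem_powerSet
    {G : Subgroup (EuclideanGroup (Fin d₁ ⊕ Fin d₂))} {S : Subgroup (EuclideanGroup (Fin d₂))}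
    {T : Set G} (hT : IsTranslationSection S T) {N : ℕ} (hN : 0 < N) {H : Subgroup G}
    (hH : (H : Set G) = powerSet T N) {s t : G} (hs : s ∈ H) (ht : t ∈ H) : Commute s t := by
  have hmem : ∀ g ∈ H, ∃ a ∈ T, ∃ v, translation v ∈ S ∧
      ProjectsTo (a : EuclideanGroup (Fin d₁ ⊕ Fin d₂)) (translation v) ∧ a ^ N = g ∧
      ProjectsTo (g : EuclideanGroup (Fin d₁ ⊕ Fin d₂)) (translation ((N : ℝ) • v)) := by
    intro g hg
    rw [← SetLike.mem_coe, hH] at hg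
    obtain ⟨a, ha, rfl⟩ := hg
    obtain ⟨v, hv, hav⟩ := hT.1 a ha
    exact ⟨a, ha, v, hv, hav, rfl, by simpa using hav.pow_translation N⟩
  obtain ⟨-, -, v, -, -, -, hsv⟩ := hmem s hs
  obtain ⟨-, -, w, -, -, -, htw⟩ := hmem t ht
  obtain ⟨a, ha, v', hv', hav, hst, hstv⟩ := hmem _ (H.mul_mem hs ht)
  obtain ⟨b, hb, w', hw', hbw, hts, htsw⟩ := hmem _ (H.mul_mem ht hs)
  -- The products `s t = a ^ N` and `t s = b ^ N` have the same translation vector, so dividing by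
  -- `N` gives `a` and `b` the same projection; the section property forces `a = b`.
  have h₁ := hstv.eq_of_translation (hsv.mul_translation htw)
  have h₂ := htsw.eq_of_translation (htw.mul_translation hsv)
  have hvw : v' = w' := by
    refine smul_right_injective _ (Nat.cast_ne_zero.mpr hN.ne' : (N : ℝ) ≠ 0) ?_
    change (N : ℝ) • v' = (N : ℝ) • w'
    rw [h₁, h₂, add_comm]
  subst hvw
  have hab : a = b := (hT.2 v' hv').unique ⟨ha, hav⟩ ⟨hb, hbw⟩
  exact (hst.symm.trans (by rw [hab])).trans hts

end Translations

/-! ### Control of the lower right block and comparison of the seminorms -/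

section Main

variable {d₁ d₂ : ℕ} {G : Subgroup (EuclideanGroup (Fin d₁ ⊕ Fin d₂))}
  {δ : (G → Space d₁ d₂) → G → ℝ}

theorem isControlled_inner_of_span {E : Type*} [NormedAddCommGroup E] [InnerProductSpace ℝ E]
    {L : (G → Space d₁ d₂) → G → E →ₗ[ℝ] E} {A : Set E}
    (h : ∀ x ∈ A, ∀ y ∈ A, IsControlled δ fun u g => inner ℝ x (L u g y)) {x y : E}
    (hx : x ∈ Submodule.span ℝ A) (hy : y ∈ Submodule.span ℝ A) :
    IsControlled δ fun u g => inner ℝ x (L u g y) := by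
  have h' : ∀ x ∈ A, IsControlled δ fun u g => inner ℝ x (L u g y) := by
    intro x hx
    induction hy using Submodule.span_induction with
    | mem y hy => exact h x hx y hy
    | zero => simpa using IsControlled.zero
    | add y y' _ _ ih ih' => simpa only [map_add, inner_add_right] using ih.add ih'
    | smul r y _ ih => simpa only [map_smul, inner_smul_right, smul_eq_mul] using ih.const_smul r
  induction hx using Submodule.span_induction with
  | mem x hx => exact h' x hx
  | zero => simpa using IsControlled.zero
  | add x x' _ _ ih ih' => simpa only [inner_add_left] using ih.add ih'
  | smul r x _ ih =>
    simpa only [real_inner_smul_left, smul_eq_mul] using ih.const_smul r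

theorem inner_toEuclideanLin_of_mem_skew {ι : Type} [Fintype ι] [DecidableEq ι] {A : Matrix ι ι ℝ}
    (hA : A ∈ skew ι) (x y : EuclideanSpace ℝ ι) :
    inner ℝ x (Matrix.toEuclideanLin A y) = -inner ℝ y (Matrix.toEuclideanLin A x) := by
  have hA' : A.transpose = -A := hA
  have h1 : ∀ x y : EuclideanSpace ℝ ι, inner ℝ x (Matrix.toEuclideanLin A y)
      = ∑ i, ∑ j, A i j * x i * y j := by
    intro x y
    rw [PiLp.inner_apply]
    refine Finset.sum_congr rfl fun i _ => ?_
    simp only [Matrix.toLpLin_apply, Matrix.mulVec, dotProduct, RCLike.inner_apply, conj_trivial,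
      Finset.sum_mul]
    exact Finset.sum_congr rfl fun j _ => by ring
  rw [h1, h1, Finset.sum_comm, ← Finset.sum_neg_distrib]
  refine Finset.sum_congr rfl fun i _ => ?_
  rw [← Finset.sum_neg_distrib]
  refine Finset.sum_congr rfl fun j _ => ?_
  have : A j i = -A i j := congrFun (congrFun hA' i) j
  rw [this]
  ring

/-- The matrix `A` with its lower right block replaced by zero. -/
def clearBlock (A : Matrix (Fin d₁ ⊕ Fin d₂) (Fin d₁ ⊕ Fin d₂) ℝ) :
    Matrix (Fin d₁ ⊕ Fin d₂) (Fin d₁ ⊕ Fin d₂) ℝ :=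
  Matrix.fromBlocks A.toBlocks₁₁ A.toBlocks₁₂ A.toBlocks₂₁ 0

theorem clearBlock_mem_skewZero {A : Matrix (Fin d₁ ⊕ Fin d₂) (Fin d₁ ⊕ Fin d₂) ℝ}
    (hA : A ∈ skew (Fin d₁ ⊕ Fin d₂)) : clearBlock A ∈ skewZero d₁ d₂ := by
  have hA' : A.transpose = -A := hA
  have hij : ∀ i j, A j i = -A i j := fun i j => congrFun (congrFun hA' i) j
  refine ⟨A.toBlocks₁₁, ?_, A.toBlocks₁₂, ?_⟩
  · ext i j
    exact hij _ _
  · have : A.toBlocks₂₁ = -A.toBlocks₁₂.transpose := by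
      ext i j
      exact hij _ _
    rw [clearBlock, this]

theorem toEuclideanLin_sub_clearBlock_inl (A : Matrix (Fin d₁ ⊕ Fin d₂) (Fin d₁ ⊕ Fin d₂) ℝ)
    (z : Space d₁ d₂) (i : Fin d₁) :
    (Matrix.toEuclideanLin A z - Matrix.toEuclideanLin (clearBlock A) z) (Sum.inl i) = 0 := by
  simp [Matrix.toLpLin_apply, Matrix.mulVec, dotProduct, clearBlock, Matrix.toBlocks₁₁,
    Matrix.toBlocks₁₂]

theorem toEuclideanLin_sub_clearBlock_inr (A : Matrix (Fin d₁ ⊕ Fin d₂) (Fin d₁ ⊕ Fin d₂) ℝ)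
    (z : Space d₁ d₂) (i : Fin d₂) :
    (Matrix.toEuclideanLin A z - Matrix.toEuclideanLin (clearBlock A) z) (Sum.inr i)
      = ∑ j, z (Sum.inr j) * A (Sum.inr i) (Sum.inr j) := by
  simp [Matrix.toLpLin_apply, Matrix.mulVec, dotProduct, clearBlock, Matrix.toBlocks₂₁, mul_comm]

theorem inner_joinZero_single (A : Matrix (Fin d₁ ⊕ Fin d₂) (Fin d₁ ⊕ Fin d₂) ℝ) (i j : Fin d₂) :
    inner ℝ (joinZero d₁ d₂ (EuclideanSpace.single i 1))
      (Matrix.toEuclideanLin A (joinZero d₁ d₂ (EuclideanSpace.single j 1)))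
      = A (Sum.inr i) (Sum.inr j) := by
  have h : ∀ k : Fin d₂, joinZero d₁ d₂ (EuclideanSpace.single k 1)
      = EuclideanSpace.single (Sum.inr k) (1 : ℝ) := by
    intro k
    ext (l | l) <;> simp [joinZero_apply, join]
  rw [h, h, EuclideanSpace.inner_single_left]
  simp [Matrix.toLpLin_apply]

variable {x₀ : Space d₁ d₂} {R : Finset G}

theorem isoSpaceZero_le_isoSpace : isoSpaceZero x₀ R ≤ isoSpace x₀ R := by
  refine sup_le_sup_left ?_ _
  rintro u ⟨A, ⟨A₁, hA₁, A₂, rfl⟩, hu⟩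
  refine ⟨_, ?_, hu⟩
  have hA₁' : A₁.transpose = -A₁ := hA₁
  change Matrix.transpose _ = -_
  rw [Matrix.fromBlocks_transpose, Matrix.fromBlocks_neg, hA₁']
  simp

theorem localDefect_le (u : G → Space d₁ d₂) (g : G) :
    localDefect x₀ R u g ≤ ‖(isoSpaceZero x₀ R)ᗮ.starProjection (patch R u g)‖ := by
  refine (norm_starProjection_orthogonal_le _ _ (isoSpaceZero_le_isoSpace
    ((isoSpaceZero x₀ R).starProjection_apply_mem (patch R u g)))).trans (le_of_eq ?_)
  rw [Submodule.starProjection_orthogonal_val]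

/-- The local distance to the infinitesimal isometries without rotation in `ℝ^d₂` is controlled by
the local distance to all infinitesimal isometries. -/
theorem isControlled_isoSpaceZero {S : Subgroup (EuclideanGroup (Fin d₂))} (hS : IsSpaceGroup S)
    {T : Set G} (hT : IsTranslationSection S T) {N : ℕ} (hN : N ∈ admissiblePeriods T)
    (hR : HasProperty2 x₀ R) :
    IsControlled (localDefect x₀ R)
      fun u g => (isoSpaceZero x₀ R)ᗮ.starProjection (patch R u g) := by
  obtain ⟨hN0, H, -, hH⟩ := hN
  choose a A hA haA using exists_skew_approximation x₀ R
  have hN' : (N : ℝ) ≠ 0 := Nat.cast_ne_zero.mpr hN0.ne'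
  obtain ⟨b, hb, hbS⟩ := hS.2
  choose t ht _ using fun i => hT.2 (b i) (hbS i)
  have hs : ∀ i, ProjectsTo ((t i ^ N : G) : EuclideanGroup (Fin d₁ ⊕ Fin d₂))
      (translation ((N : ℝ) • b i)) := fun i => by simpa using (ht i).2.pow_translation N
  have hsH : ∀ i, t i ^ N ∈ H := fun i => by
    rw [← SetLike.mem_coe, hH]
    exact ⟨t i, (ht i).1, rfl⟩
  have hℓ := isControlled_sub_affineField hR haA
  have hact : ∀ i z, act (t i ^ N) z
      = rotEnd (t i ^ N) z + joinZero d₁ d₂ ((N : ℝ) • b i) := fun i z => by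
    rw [← (hs i).zero_apply]
    exact apply_eq_rot_add _ z
  have hlat : ∀ i j, IsControlled (localDefect x₀ R) fun u g =>
      inner ℝ (joinZero d₁ d₂ ((N : ℝ) • b i))
        (Matrix.toEuclideanLin (A u g) (joinZero d₁ d₂ ((N : ℝ) • b j))) := fun i j =>
    isControlled_inner_linear hℓ (fun u g => inner_toEuclideanLin_of_mem_skew (hA u g))
      (hT.commute_of_mem_powerSet hN0 hH (hsH j) (hsH i)) (hact j) (hact i)
      ((hs j).rot_joinZero _) ((hs j).rot_joinZero _) ((hs i).rot_joinZero _)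
      ((hs i).rot_joinZero _)
  have hspan : ∀ y : EuclideanSpace ℝ (Fin d₂), joinZero d₁ d₂ y ∈
      Submodule.span ℝ (Set.range fun i => joinZero d₁ d₂ ((N : ℝ) • b i)) := by
    intro y
    have hy : y ∈ Submodule.span ℝ (Set.range b) := by
      rw [hb.span_eq_top_of_card_eq_finrank' (by simp)]
      trivial
    induction hy using Submodule.span_induction with
    | mem y hy =>
      obtain ⟨i, rfl⟩ := hy
      have h : b i = (N : ℝ)⁻¹ • (N : ℝ) • b i := (inv_smul_smul₀ hN' _).symm
      rw [h, map_smul]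
      exact Submodule.smul_mem _ _ (Submodule.subset_span ⟨i, rfl⟩)
    | zero => rw [map_zero]; exact Submodule.zero_mem _
    | add y y' _ _ ih ih' => rw [map_add]; exact Submodule.add_mem _ ih ih'
    | smul r y _ ih => rw [map_smul]; exact Submodule.smul_mem _ r ih
  have hentry : ∀ i j : Fin d₂, IsControlled (localDefect x₀ R) fun u g =>
      A u g (Sum.inr i) (Sum.inr j) := by
    intro i j
    simp only [← inner_joinZero_single]
    refine isControlled_inner_of_span ?_ (hspan _) (hspan _)
    rintro _ ⟨i, rfl⟩ _ ⟨j, rfl⟩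
    exact hlat i j
  have hclear : ∀ z : Space d₁ d₂, IsControlled (localDefect x₀ R) fun u g =>
      Matrix.toEuclideanLin (A u g) z - Matrix.toEuclideanLin (clearBlock (A u g)) z := by
    intro z
    refine IsControlled.piLp ?_
    rintro (i | i)
    · simp only [toEuclideanLin_sub_clearBlock_inl]
      exact IsControlled.zero
    · simp only [toEuclideanLin_sub_clearBlock_inr]
      exact IsControlled.sum _ fun j _ => (hentry i j).const_smul (z (Sum.inr j))
  -- A competitor in the smaller space: the approximating field with its lower right block deleted.
  -- Its extra error on the patch is linear in the deleted entries.
  let W : (G → Space d₁ d₂) → G → PatchMap R := fun u g => WithLp.toLp 2 fun h =>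
    (rot (h : G).1).symm (affineField x₀ (a u g) (clearBlock (A u g)) (act (h : G) x₀))
  have hW : ∀ u g, W u g ∈ isoSpaceZero x₀ R := by
    intro u g
    refine Submodule.mem_sup.mpr
      ⟨WithLp.toLp 2 fun h => (rot (h : G).1).symm (a u g), ⟨a u g, fun h => ?_⟩,
        WithLp.toLp 2 fun h => (rot (h : G).1).symm
          (Matrix.toEuclideanLin (clearBlock (A u g)) (act (h : G) x₀ - x₀)),
        ⟨_, clearBlock_mem_skewZero (hA u g), fun h => ?_⟩, ?_⟩
    · exact LinearIsometryEquiv.apply_symm_apply _ _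
    · exact LinearIsometryEquiv.apply_symm_apply _ _
    · refine congrArg (WithLp.toLp 2) (funext fun h => ?_)
      exact (map_add (rot (h : G).1).symm _ _).symm
  have hpatch : IsControlled (localDefect x₀ R) fun u g => patch R u g - W u g := by
    refine IsControlled.piLp fun h => ?_
    refine (hℓ h).add (hclear (act (h : G) x₀ - x₀)) |>.mono 1 fun u g => le_of_eq ?_
    rw [one_mul, ← (rot (h : G).1).norm_map]
    congr 1
    change rot (h : G).1 (u (g * h) - (rot (h : G).1).symm (a u g +
      Matrix.toEuclideanLin (clearBlock (A u g)) (act (h : G) x₀ - x₀))) =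
      (rot (h : G).1 (u (g * h)) - (a u g +
        Matrix.toEuclideanLin (A u g) (act (h : G) x₀ - x₀))) + _
    rw [map_sub, LinearIsometryEquiv.apply_symm_apply]
    abel
  exact hpatch.mono 1 fun u g => by
    rw [one_mul]
    exact norm_starProjection_orthogonal_le _ _ (hW u g)

/-- Both seminorms carry the same factor `1 / |C|`, so comparing the unnormalized sums suffices. -/
theorem patchSeminorm_le_of_sum_le {U U' : Submodule ℝ (PatchMap R)} {C : Finset G}
    {u : G → Space d₁ d₂} {K : ℝ} (hK : 0 ≤ K)
    (h : ∑ g ∈ C, ‖Uᗮ.starProjection (patch R u g)‖ ^ 2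
      ≤ K ^ 2 * ∑ g ∈ C, ‖U'ᗮ.starProjection (patch R u g)‖ ^ 2) :
    patchSeminorm R U C u ≤ K * patchSeminorm R U' C u := by
  rw [patchSeminorm, patchSeminorm, ← Real.sqrt_sq hK, ← Real.sqrt_mul (sq_nonneg _)]
  refine Real.sqrt_le_sqrt ?_
  rw [mul_left_comm]
  exact mul_le_mul_of_nonneg_left h (by positivity)

end Main

end

end ObjectiveStructure

theorem theorem3 (d₁ d₂ : ℕ)
    (S : Subgroup (ObjectiveStructure.EuclideanGroup (Fin d₂)))
    (hS : ObjectiveStructure.IsSpaceGroup S)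
    (G : Subgroup (ObjectiveStructure.EuclideanGroup (Fin d₁ ⊕ Fin d₂)))
    (hG : ObjectiveStructure.IsDiscreteGroup G)
    (hGS : ObjectiveStructure.ProjectsOnto G S)
    (T : Set G) (hT : ObjectiveStructure.IsTranslationSection S T)
    (x₀ : ObjectiveStructure.Space d₁ d₂)
    (hx₀ : Function.Injective fun g : G => ObjectiveStructure.act g x₀)
    (R : Finset G) (hR : ObjectiveStructure.HasProperty2 x₀ R) :
    ∃ c C : ℝ, 0 < c ∧ 0 < C ∧
      ∀ N ∈ ObjectiveStructure.admissiblePeriods T,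
      ∀ CN : Finset G, ObjectiveStructure.IsRepresentationSet T N CN →
      ∀ u : G → ObjectiveStructure.Space d₁ d₂, ObjectiveStructure.IsPeriodic T N u →
        c * ObjectiveStructure.intrinsicSeminorm x₀ R CN u
            ≤ ObjectiveStructure.rigiditySeminorm x₀ R CN u ∧
        ObjectiveStructure.rigiditySeminorm x₀ R CN u
            ≤ C * ObjectiveStructure.intrinsicSeminorm x₀ R CN u := by
  by_cases hM : ∃ N, N ∈ ObjectiveStructure.admissiblePeriods T
  swap
  · exact ⟨1, 1, one_pos, one_pos, fun N hN => absurd ⟨N, hN⟩ hM⟩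
  obtain ⟨N₀, hN₀⟩ := hM
  -- A single admissible `N₀` supplies the commuting elements; the resulting `K` serves all normal
  -- subgroups, hence every period `N`.
  obtain ⟨K, hK, hcontrol⟩ := ObjectiveStructure.isControlled_isoSpaceZero hS hT hN₀ hR
  -- Adding 1 keeps the constant positive when `K = 0`, and `K ≤ (√K + 1)²`.
  have hpos : 0 < √K + 1 := by positivity
  refine ⟨(√K + 1)⁻¹, 1, inv_pos.mpr hpos, one_pos, fun N hN CN hCN u hu => ⟨?_, ?_⟩⟩
  · obtain ⟨-, H, hHn, hH⟩ := hN
    have hmem : ∀ t, t ∈ H ↔ t ∈ ObjectiveStructure.powerSet T N := fun t => by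
      rw [← hH, SetLike.mem_coe]
    have hC : ObjectiveStructure.IsTransversal H CN := fun g => by
      simpa only [hmem] using hCN g
    have hle := hcontrol H hHn CN hC u fun g t ht => (hu g t ((hmem t).mp ht)).symm
    rw [inv_mul_le_iff₀ hpos]
    refine ObjectiveStructure.patchSeminorm_le_of_sum_le hpos.le (hle.trans ?_)
    refine mul_le_mul_of_nonneg_right ?_ (Finset.sum_nonneg fun _ _ => sq_nonneg _)
    nlinarith [Real.sq_sqrt hK, Real.sqrt_nonneg K]
  · refine ObjectiveStructure.patchSeminorm_le_of_sum_le zero_le_one ?_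
    rw [one_pow, one_mul]
    exact Finset.sum_le_sum fun g _ =>
      pow_le_pow_left₀ (norm_nonneg _) (ObjectiveStructure.localDefect_le u g) 2
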